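/- Let $H$ be an infinite-dimensional complex Hilbert space, let $G$ be a locally compact Hausdorff étale groupoid with unit space $G^{(0)}$, and let $\Sigma$ be a twist over $G$, that is, a locally compact Hausdorff groupoid $\Sigma$ together with a central extension $G^{(0)}\times\mathbb T\to\Sigma\to G$ of topological groupoids that is locally trivial as a $\mathbb T$-bundle over $G$. Let $C_r^*(G,\Sigma)$ be the reduced twisted groupoid $C^*$-algebra, i.e. the completion of the convolution $*$-algebra of continuous compactly supported $\mathbb T$-equivariant functions on $\Sigma$ in the norm $\|f\|_r=\sup_{u\in G^{(0)}}\|\lambda_u(f)\|$, where $\lambda_u$ is the regular representation at $u$. If $$C_0(G^{(0)})\cong\ell^\infty(X)$$ as $C^*$-algebras for some infinite set $X$, then $C_r^*(G,\Sigma)$ is not $*$-isomorphic to $B(H)$. -/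

import Mathlib

open scoped ENNReal ZeroAtInfty Topology

/-- A topological groupoid, given by its space `G` of arrows. The units are the arrows `u` with
`src u = u`. The product `gmul g h` has a meaning only on composable pairs, those with
`src g = rng h`: no law, no continuity requirement and no construction below refers to its values
elsewhere. -/
class TopGroupoid (G : Type*) [TopologicalSpace G] where
  /-- source -/
  src : G → G
  /-- range -/
  rng : G → G
  /-- product of composable arrows -/
  gmul : G → G → G
  /-- inverse -/
  ginv : G → G
  src_src : ∀ g, src (src g) = src g
  rng_src : ∀ g, rng (src g) = src g
  src_rng : ∀ g, src (rng g) = rng g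
  rng_rng : ∀ g, rng (rng g) = rng g
  src_gmul : ∀ g h, src g = rng h → src (gmul g h) = src h
  rng_gmul : ∀ g h, src g = rng h → rng (gmul g h) = rng g
  gmul_assoc : ∀ g h k, src g = rng h → src h = rng k →
    gmul (gmul g h) k = gmul g (gmul h k)
  rng_mul_self : ∀ g, gmul (rng g) g = g
  mul_src_self : ∀ g, gmul g (src g) = g
  src_ginv : ∀ g, src (ginv g) = rng g
  rng_ginv : ∀ g, rng (ginv g) = src g
  ginv_mul_self : ∀ g, gmul (ginv g) g = src g
  mul_ginv_self : ∀ g, gmul g (ginv g) = rng g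
  continuous_ginv : Continuous ginv
  continuousOn_gmul : ContinuousOn (fun p : G × G => gmul p.1 p.2) {p | src p.1 = rng p.2}

namespace TopGroupoid

section Groupoid

variable {G : Type*} [TopologicalSpace G] [TopGroupoid G]

variable (G) in
/-- The unit space, with the subspace topology. -/
def unitSpace : Set G := {u | src u = u}

/-- The source map as a map onto the unit space. -/
def srcUnit (g : G) : unitSpace G := ⟨src g, src_src g⟩

/-- The range map as a map onto the unit space. -/
def rngUnit (g : G) : unitSpace G := ⟨rng g, src_rng g⟩

variable (G) in
/-- A topological groupoid is étale if its source map is a local homeomorphism onto the unit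
space (equivalently, its range map is one, the two being exchanged by inversion). -/
def IsEtale : Prop := IsLocalHomeomorph (srcUnit : G → unitSpace G)

/-- The source fibre `G_u`. -/
abbrev Fibre (u : unitSpace G) : Type _ := {g : G // src g = (u : G)}

theorem gmul_ginv_injective {g h k : G} (h1 : src g = src h) (h2 : src g = src k)
    (e : gmul g (ginv h) = gmul g (ginv k)) : h = k := by
  have key : ∀ x : G, src g = src x → gmul (ginv g) (gmul g (ginv x)) = ginv x := by
    intro x hx
    rw [← gmul_assoc _ _ _ (src_ginv g) (by rw [rng_ginv, hx]), ginv_mul_self, hx, ← rng_ginv x,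
      rng_mul_self]
  have hi : ∀ x : G, ginv (ginv x) = x := by
    intro x
    have a := gmul_assoc (ginv (ginv x)) (ginv x) x (by rw [src_ginv]) (by rw [src_ginv])
    rw [ginv_mul_self (ginv x), ginv_mul_self x, src_ginv, rng_mul_self] at a
    have b := mul_src_self (ginv (ginv x))
    rw [src_ginv, rng_ginv] at b
    exact b.symm.trans a.symm
  have := key h h1
  rw [e, key k h2] at this
  rw [← hi h, ← this, hi]

/-- A compact subset of an étale groupoid meets all source fibres and all range fibres in at most
`m` points, for some `m`. -/
theorem IsEtale.exists_fibre_bound (hG : IsEtale G) {K : Set G} (hK : IsCompact K) :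
    ∃ m : ℕ, ∀ u : G, {g | g ∈ K ∧ src g = u}.encard ≤ m ∧ {g | g ∈ K ∧ rng g = u}.encard ≤ m := by
  have hs : ∀ g : G, ∃ U : Set G, IsOpen U ∧ g ∈ U ∧ Set.InjOn src U ∧ Set.InjOn rng U := by
    have h0 : ∀ g : G, ∃ U : Set G, IsOpen U ∧ g ∈ U ∧ Set.InjOn src U := by
      intro g
      obtain ⟨e, he, h⟩ := hG g
      refine ⟨e.source, e.open_source, he, fun x hx y hy hxy => e.injOn hx hy ?_⟩
      rw [← h]
      exact Subtype.ext hxy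
    intro g
    obtain ⟨U, hU, hgU, hUi⟩ := h0 g
    obtain ⟨V, hV, hgV, hVi⟩ := h0 (ginv g)
    refine ⟨U ∩ ginv ⁻¹' V, hU.inter (hV.preimage continuous_ginv), ⟨hgU, hgV⟩,
      hUi.mono Set.inter_subset_left, ?_⟩
    intro x hx y hy hxy
    have e : ginv x = ginv y := hVi hx.2 hy.2 (by rw [src_ginv, src_ginv, hxy])
    have e2 : src x = src y := by rw [← rng_ginv, e, rng_ginv]
    exact hUi hx.1 hy.1 e2
  choose U hUo hUm hUs hUr using hs
  obtain ⟨J, -, hJ⟩ := hK.elim_nhds_subcover U (fun g _ => (hUo g).mem_nhds (hUm g))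
  refine ⟨J.card, fun u => ?_⟩
  have hc : ∀ g ∈ K, ∃ j ∈ J, g ∈ U j := by
    intro g hg
    simpa using hJ hg
  choose! j hjJ hjU using hc
  have hcard : (J.card : ℕ∞) = (J : Set G).encard := by simp
  constructor
  · rw [hcard]
    refine Set.encard_le_encard_of_injOn (f := j) (fun g hg => hjJ g hg.1) ?_
    intro x hx y hy hxy
    refine hUs (j x) (hjU x hx.1) (hxy ▸ hjU y hy.1) (hx.2.trans hy.2.symm)
  · rw [hcard]
    refine Set.encard_le_encard_of_injOn (f := j) (fun g hg => hjJ g hg.1) ?_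
    intro x hx y hy hxy
    refine hUr (j x) (hjU x hx.1) (hxy ▸ hjU y hy.1) (hx.2.trans hy.2.symm)

end Groupoid

/-- A twist over `G`: a central groupoid extension `G⁽⁰⁾ × 𝕋 → S → G`, where `G⁽⁰⁾ × 𝕋` is the
trivial bundle of circle groups, that is locally trivial as a `𝕋`-bundle. The total space `S` is
assumed to be locally compact and Hausdorff where twists are used. The conditions imply that `proj`
and `incl (·, 1)` restrict to mutually inverse homeomorphisms of the unit spaces. -/
structure Twist (G S : Type*) [TopologicalSpace G] [TopGroupoid G]
    [TopologicalSpace S] [TopGroupoid S] where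
  /-- the inclusion `G⁽⁰⁾ × 𝕋 → S` -/
  incl : unitSpace G × Circle → S
  /-- the projection `S → G` -/
  proj : S → G
  continuous_incl : Continuous incl
  continuous_proj : Continuous proj
  -- `incl` is an injective groupoid homomorphism
  src_incl : ∀ u z, src (incl (u, z)) = incl (u, 1)
  rng_incl : ∀ u z, rng (incl (u, z)) = incl (u, 1)
  incl_mul : ∀ u z w, gmul (incl (u, z)) (incl (u, w)) = incl (u, z * w)
  incl_injective : Function.Injective incl
  -- `proj` is a surjective groupoid homomorphism
  proj_src : ∀ σ, proj (src σ) = src (proj σ)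
  proj_rng : ∀ σ, proj (rng σ) = rng (proj σ)
  proj_mul : ∀ σ τ, src σ = rng τ → proj (gmul σ τ) = gmul (proj σ) (proj τ)
  proj_surjective : Function.Surjective proj
  -- exactness
  proj_eq_iff : ∀ (u : unitSpace G) σ, proj σ = u ↔ ∃ z, incl (u, z) = σ
  -- centrality
  central : ∀ σ z, gmul (incl (rngUnit (proj σ), z)) σ = gmul σ (incl (srcUnit (proj σ), z))
  -- local triviality
  locally_trivial : ∀ g : G, ∃ U : Set G, IsOpen U ∧ g ∈ U ∧ ∃ c : U → S, Continuous c ∧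
    (∀ x, proj (c x) = x) ∧ ∃ φ : (U × Circle) ≃ₜ (proj ⁻¹' U),
      ∀ x z, (φ (x, z) : S) = gmul (incl (rngUnit (x : G), z)) (c x)

namespace Twist

variable {G S : Type*} [TopologicalSpace G] [TopGroupoid G] [TopologicalSpace S] [TopGroupoid S]

/-- The action of the circle on the total space of a twist. -/
def act (E : Twist G S) (z : Circle) (σ : S) : S := gmul (E.incl (rngUnit (E.proj σ), z)) σ

/-- `C_c(G, Σ)`: the continuous compactly supported sections of the line bundle of the twist, as
continuous compactly supported `𝕋`-equivariant functions on the total space. -/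
structure CompactSection (E : Twist G S) where
  toFun : S → ℂ
  continuous_toFun : Continuous toFun
  hasCompactSupport : HasCompactSupport toFun
  equivariant : ∀ (z : Circle) (σ : S), toFun (E.act z σ) = (z : ℂ) * toFun σ

/-- A set-theoretic section of the projection of a twist, not continuous in general. -/
noncomputable def lift (E : Twist G S) : G → S := Function.surjInv E.proj_surjective

theorem proj_lift (E : Twist G S) (g : G) : E.proj (E.lift g) = g :=
  Function.surjInv_eq E.proj_surjective g

theorem proj_ginv (E : Twist G S) (σ : S) : E.proj (ginv σ) = ginv (E.proj σ) := by
  have h1 : gmul (E.proj (ginv σ)) (E.proj σ) = src (E.proj σ) := by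
    rw [← E.proj_mul _ _ (src_ginv σ), ginv_mul_self, E.proj_src]
  have h2 : src (E.proj (ginv σ)) = rng (E.proj σ) := by
    rw [← E.proj_src, src_ginv, E.proj_rng]
  have h3 := gmul_assoc (E.proj (ginv σ)) (E.proj σ) (ginv (E.proj σ)) h2 (by rw [rng_ginv])
  rw [h1, mul_ginv_self, ← h2, mul_src_self] at h3
  rw [← h3, ← rng_ginv, rng_mul_self]

theorem src_eq_of_proj (E : Twist G S) {σ τ : S} (h : src (E.proj σ) = src (E.proj τ)) :
    src σ = src τ := by
  have key : ∀ ρ : S, src ρ = E.incl (srcUnit (E.proj ρ), 1) := by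
    intro ρ
    obtain ⟨z, hz⟩ := (E.proj_eq_iff (srcUnit (E.proj ρ)) (src ρ)).1 (E.proj_src ρ)
    rw [← E.src_incl _ z, hz, src_src]
  rw [key σ, key τ]
  have : srcUnit (E.proj σ) = srcUnit (E.proj τ) := Subtype.ext h
  rw [this]

theorem proj_lift_mul (E : Twist G S) {g h : G} (e : src g = src h) :
    E.proj (gmul (E.lift g) (ginv (E.lift h))) = gmul g (ginv h) := by
  have : src (E.lift g) = src (E.lift h) := E.src_eq_of_proj (by rw [proj_lift, proj_lift, e])
  rw [E.proj_mul _ _ (by rw [rng_ginv, this]), proj_ginv, proj_lift, proj_lift]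

end Twist

end TopGroupoid

/-- A matrix with bounded entries and at most `m` nonzero entries in every row and column acts
on `ℓ²`, with norm at most `m` times the bound. -/
theorem exists_operator_of_sparse {ι κ : Type*} (a : ι → κ → ℂ) (m : ℕ) (M : ℝ) (hM : 0 ≤ M)
    (ha : ∀ i k, ‖a i k‖ ≤ M) (hrow : ∀ i, {k | a i k ≠ 0}.encard ≤ m)
    (hcol : ∀ k, {i | a i k ≠ 0}.encard ≤ m) :
    ∃ T : lp (fun _ : κ => ℂ) 2 →L[ℂ] lp (fun _ : ι => ℂ) 2,
      ‖T‖ ≤ m * M ∧ ∀ ξ i, T ξ i = ∑' k, a i k * ξ k := by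
  classical
  have hrf : ∀ i, {k | a i k ≠ 0}.Finite := fun i => Set.finite_of_encard_le_coe (hrow i)
  have hcf : ∀ k, {i | a i k ≠ 0}.Finite := fun k => Set.finite_of_encard_le_coe (hcol k)
  have hts : ∀ (ξ : κ → ℂ) i, ∑' k, a i k * ξ k = ∑ k ∈ (hrf i).toFinset, a i k * ξ k := by
    intro ξ i
    refine tsum_eq_sum fun k hk => ?_
    have : a i k = 0 := by simpa using hk
    simp [this]
  have hrc : ∀ i, (hrf i).toFinset.card ≤ m := fun i => by
    have := hrow i
    rw [(hrf i).encard_eq_coe_toFinset_card] at this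
    exact_mod_cast this
  have hcc : ∀ k, (hcf k).toFinset.card ≤ m := fun k => by
    have := hcol k
    rw [(hcf k).encard_eq_coe_toFinset_card] at this
    exact_mod_cast this
  have hbound : ∀ (ξ : lp (fun _ : κ => ℂ) 2) (F : Finset ι),
      ∑ i ∈ F, ‖∑' k, a i k * ξ k‖ ^ (2 : ℝ≥0∞).toReal
        ≤ ((m * M) * ‖ξ‖) ^ (2 : ℝ≥0∞).toReal := by
    intro ξ F
    simp only [ENNReal.toReal_ofNat, Real.rpow_ofNat]
    have h1 : ∀ i, ‖∑' k, a i k * ξ k‖ ^ 2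
        ≤ m * M ^ 2 * ∑ k ∈ (hrf i).toFinset, ‖ξ k‖ ^ 2 := by
      intro i
      rw [hts]
      calc ‖∑ k ∈ (hrf i).toFinset, a i k * ξ k‖ ^ 2
          ≤ (∑ k ∈ (hrf i).toFinset, M * ‖ξ k‖) ^ 2 := by
            gcongr
            refine (norm_sum_le _ _).trans (Finset.sum_le_sum fun k _ => ?_)
            rw [norm_mul]
            gcongr
            exact ha i k
        _ ≤ (hrf i).toFinset.card * ∑ k ∈ (hrf i).toFinset, (M * ‖ξ k‖) ^ 2 :=
            sq_sum_le_card_mul_sum_sq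
        _ ≤ m * ∑ k ∈ (hrf i).toFinset, (M * ‖ξ k‖) ^ 2 := by
            gcongr
            exact_mod_cast hrc i
        _ = m * M ^ 2 * ∑ k ∈ (hrf i).toFinset, ‖ξ k‖ ^ 2 := by
            simp only [mul_pow, ← Finset.mul_sum, mul_assoc]
    have h2 : ∑ i ∈ F, ∑ k ∈ (hrf i).toFinset, ‖ξ k‖ ^ 2 ≤ m * ‖ξ‖ ^ 2 := by
      have hsw : ∑ i ∈ F, ∑ k ∈ (hrf i).toFinset, ‖ξ k‖ ^ 2
          = ∑ k ∈ F.biUnion fun i => (hrf i).toFinset,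
              ∑ i ∈ F ∩ (hcf k).toFinset, ‖ξ k‖ ^ 2 := by
        refine Finset.sum_comm' fun i k => ?_
        simp only [Finset.mem_biUnion, Finset.mem_inter, Set.Finite.mem_toFinset, Set.mem_ofPred_eq]
        constructor
        · exact fun h => ⟨h, i, h⟩
        · exact fun h => h.1
      rw [hsw]
      have hn := lp.sum_rpow_le_norm_rpow (p := 2) (by simp) ξ
        (F.biUnion fun i => (hrf i).toFinset)
      simp only [ENNReal.toReal_ofNat, Real.rpow_ofNat] at hn
      refine le_trans ?_ (mul_le_mul_of_nonneg_left hn (Nat.cast_nonneg m))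
      rw [Finset.mul_sum]
      refine Finset.sum_le_sum fun k _ => ?_
      rw [Finset.sum_const, nsmul_eq_mul]
      gcongr
      exact (Finset.card_le_card Finset.inter_subset_right).trans (hcc k)
    calc ∑ i ∈ F, ‖∑' k, a i k * ξ k‖ ^ 2
        ≤ ∑ i ∈ F, m * M ^ 2 * ∑ k ∈ (hrf i).toFinset, ‖ξ k‖ ^ 2 :=
          Finset.sum_le_sum fun i _ => h1 i
      _ = m * M ^ 2 * ∑ i ∈ F, ∑ k ∈ (hrf i).toFinset, ‖ξ k‖ ^ 2 := by rw [Finset.mul_sum]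
      _ ≤ m * M ^ 2 * (m * ‖ξ‖ ^ 2) := by gcongr
      _ = (m * M * ‖ξ‖) ^ 2 := by ring
  let L : lp (fun _ : κ => ℂ) 2 →ₗ[ℂ] lp (fun _ : ι => ℂ) 2 :=
    { toFun := fun ξ => ⟨fun i => ∑' k, a i k * ξ k, memℓp_gen' (hbound ξ)⟩
      map_add' := fun ξ η => by
        ext i
        simp only [lp.coeFn_add, hts]
        simp only [Pi.add_apply, mul_add, Finset.sum_add_distrib]
      map_smul' := fun c ξ => by
        ext i
        simp only [lp.coeFn_smul, Pi.smul_apply, hts, smul_eq_mul, Finset.mul_sum,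
          RingHom.id_apply]
        exact Finset.sum_congr rfl fun k _ => by ring }
  refine ⟨L.mkContinuous (m * M) fun ξ => ?_, L.mkContinuous_norm_le (by positivity) _,
    fun ξ i => rfl⟩
  exact lp.norm_le_of_forall_sum_le (by simp) (by positivity) (hbound ξ)

namespace TopGroupoid.Twist

variable {G S : Type*} [TopologicalSpace G] [TopGroupoid G] [TopologicalSpace S] [TopGroupoid S]

variable (G) in
/-- The C⋆-algebra `∏_u B(ℓ²(G_u))` of bounded families of operators, indexed by the units `u`, with
the supremum norm. -/
abbrev FibreOperators : Type _ :=
  lp (fun u : unitSpace G => lp (fun _ : Fibre u => ℂ) 2 →L[ℂ] lp (fun _ : Fibre u => ℂ) 2) ∞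

noncomputable instance : NonUnitalCStarAlgebra (FibreOperators G) := inferInstance

noncomputable instance : StarModule ℂ (FibreOperators G) := inferInstance

/-- A compactly supported section acts boundedly on all `ℓ²(G_u)`, uniformly in `u`. -/
theorem exists_regularRep (E : Twist G S) (hG : IsEtale G) (f : E.CompactSection) :
    ∃ T : FibreOperators G, ∀ (u : unitSpace G) (ξ : lp (fun _ : Fibre u => ℂ) 2) (α : Fibre u),
      T u ξ α = ∑' β : Fibre u, f.toFun (gmul (E.lift α) (ginv (E.lift β))) * ξ β := by
  obtain ⟨M, hM⟩ := f.hasCompactSupport.exists_bound_of_continuous f.continuous_toFun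
  obtain ⟨m, hm⟩ := hG.exists_fibre_bound (f.hasCompactSupport.image E.continuous_proj)
  have key : ∀ {α β : G}, src α = src β → f.toFun (gmul (E.lift α) (ginv (E.lift β))) ≠ 0 →
      gmul α (ginv β) ∈ E.proj '' tsupport f.toFun := by
    intro α β e h
    rw [← E.proj_lift_mul e]
    exact Set.mem_image_of_mem _ (subset_tsupport _ h)
  have hex := fun u : unitSpace G => exists_operator_of_sparse
    (fun α β : Fibre u => f.toFun (gmul (E.lift α) (ginv (E.lift β)))) m (max M 0)
    (le_max_right _ _) (fun α β => (hM _).trans (le_max_left _ _))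
    (fun α => by
      refine (Set.encard_le_encard_of_injOn
        (f := fun β : Fibre u => gmul (α : G) (ginv (β : G))) ?_ ?_).trans (hm (rng (α : G))).2
      · intro β hβ
        have e : src (α : G) = src (β : G) := α.2.trans β.2.symm
        exact ⟨key e hβ, rng_gmul _ _ (by rw [rng_ginv, e])⟩
      · intro β _ γ _ h
        exact Subtype.ext (gmul_ginv_injective (α.2.trans β.2.symm) (α.2.trans γ.2.symm) h))
    (fun β => by
      refine (Set.encard_le_encard_of_injOn
        (f := fun α : Fibre u => gmul (α : G) (ginv (β : G))) ?_ ?_).trans (hm (rng (β : G))).1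
      · intro α hα
        have e : src (α : G) = src (β : G) := α.2.trans β.2.symm
        exact ⟨key e hα, by rw [src_gmul _ _ (by rw [rng_ginv, e]), src_ginv]⟩
      · intro α _ γ _ h
        have c : ∀ x : Fibre u, gmul (gmul (x : G) (ginv (β : G))) β = x := by
          intro x
          have e : src (x : G) = src (β : G) := x.2.trans β.2.symm
          rw [gmul_assoc _ _ _ (by rw [rng_ginv, e]) (by rw [src_ginv]), ginv_mul_self, ← e,
            mul_src_self]
        have h' : gmul (α : G) (ginv (β : G)) = gmul (γ : G) (ginv (β : G)) := h
        exact Subtype.ext (by rw [← c α, h', c γ]))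
  choose T hT using hex
  exact ⟨⟨T, memℓp_infty ⟨m * max M 0, by rintro _ ⟨u, rfl⟩; exact (hT u).1⟩⟩,
    fun u => (hT u).2⟩

/-- The family `(λ_u(f))_u` of regular representations of a compactly supported section `f`. The
Hilbert space of square summable `𝕋`-equivariant functions on the fibre of the twist over `G_u` is
identified with `ℓ²(G_u)` through `ξ ↦ ξ ∘ lift`, so that the convolution
`(f * ξ)(σ) = ∑ β ∈ G_u, f(σ lift(β)⁻¹) ξ(lift β)` becomes the formula in `regularRep_apply`, which
determines the family. Another section of the projection in place of `lift` yields a unitarily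
equivalent family. -/
noncomputable def regularRep (E : Twist G S) (hG : IsEtale G) (f : E.CompactSection) :
    FibreOperators G :=
  (E.exists_regularRep hG f).choose

theorem regularRep_apply (E : Twist G S) (hG : IsEtale G) (f : E.CompactSection)
    (u : unitSpace G) (ξ : lp (fun _ : Fibre u => ℂ) 2) (α : Fibre u) :
    E.regularRep hG f u ξ α
      = ∑' β : Fibre u, f.toFun (gmul (E.lift α) (ginv (E.lift β))) * ξ β :=
  (E.exists_regularRep hG f).choose_spec u ξ α

/-- The reduced twisted groupoid C⋆-algebra: the completion of `C_c(G, Σ)` in the norm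
`‖f‖ = sup_u ‖λ_u(f)‖`, realized as the norm closure in `∏_u B(ℓ²(G_u))` of the ⋆-algebra generated by the families
`(λ_u(f))_u` with `f ∈ C_c(G, Σ)`. (For the convolution product and the involution of `C_c(G, Σ)`
these families already form a ⋆-algebra, so nothing else is generated.) -/
noncomputable def reducedCStarAlgebra (E : Twist G S) (hG : IsEtale G) :
    NonUnitalStarSubalgebra ℂ (FibreOperators G) :=
  (NonUnitalStarAlgebra.adjoin ℂ (Set.range (E.regularRep hG))).topologicalClosure

end TopGroupoid.Twist

/-!
The commutative algebra `C₀(G⁽⁰⁾) ≅ ℓ^∞(X)` has a minimal projection for every point of `X`. As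
`C₀(G⁽⁰⁾)` separates points, these projections are the indicators of distinct isolated units
(`exists_injective_isOpen_singleton`). The group of the twist over an isolated unit `x` is an open
and compact circle, so the indicator of `x` lifts to a compactly supported section
(`Twist.unitSection`), and the reduced algebra contains infinitely many nonzero orthogonal
projections `e x`.

A compact set of arrows in an étale groupoid has boundedly many arrows with a given source or range.
Hence, for a compactly supported section `b` and a given `y`, only boundedly many of the corners
`e x * b * e y` are nonzero, and this passes to sums, products and adjoints
(`exists_boundedDegree_propagatesAlong`). So such sparse elements are dense in the reduced algebra.

In `B(H)` they cannot be dense. Pick unit vectors `ξ x` in the ranges of the images of the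
projections; they are orthonormal. Among them choose vectors `v N` and disjoint blocks of `N + 1`
vectors. Some operator maps each `v N` to the normalized sum of the `N`-th block. The image of
`v N` under a sparse operator is orthogonal to all but `m` vectors of the block, with `m`
independent of `N`, so it stays at distance at least `1/2` from that sum for large `N`
(`Orthonormal.exists_half_le_norm_sub_of_sparse`).
-/

/-! ### Operators that are far from every operator with sparse columns -/

section HilbertSpace

open scoped InnerProductSpace

variable {H : Type*} [NormedAddCommGroup H] [InnerProductSpace ℂ H]

theorem Orthonormal.exists_continuousLinearMap_apply_eq [CompleteSpace H] {ι : Type*} {v w : ι → H}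
    (hv : Orthonormal ℂ v) (hw : Orthonormal ℂ w) : ∃ T : H →L[ℂ] H, ∀ i, T (v i) = w i := by
  classical
  let V := hv.orthogonalFamily.linearIsometry
  let W := hw.orthogonalFamily.linearIsometry
  have hV : ∀ i, V (lp.single 2 i (1 : ℂ)) = v i := fun i => by
    simp [V]
  have hW : ∀ i, W (lp.single 2 i (1 : ℂ)) = w i := fun i => by
    simp [W]
  refine ⟨W.toContinuousLinearMap ∘L V.toContinuousLinearMap.adjoint, fun i => ?_⟩
  have hVV : V.toContinuousLinearMap.adjoint (V (lp.single 2 i (1 : ℂ))) = lp.single 2 i 1 :=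
    ext_inner_left ℂ fun x => by
      rw [ContinuousLinearMap.adjoint_inner_right]
      exact V.inner_map_map _ _
  rw [← hV i, ContinuousLinearMap.comp_apply, hVV]
  exact hW i

theorem orthonormal_blockAverage {ξ : ℕ × ℕ → H} (hξ : Orthonormal ℂ ξ) :
    Orthonormal ℂ fun N : ℕ =>
      ((√(N + 1 : ℝ) : ℂ))⁻¹ • ∑ k ∈ Finset.range (N + 1), ξ (N, k) := by
  rw [orthonormal_iff_ite] at hξ ⊢
  intro N M
  simp only [inner_smul_left, inner_smul_right, sum_inner, inner_sum, hξ, Prod.mk.injEq]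
  split_ifs with h
  · subst h
    have h0 : (0 : ℝ) ≤ N + 1 := by positivity
    have h1 : ((√(N + 1 : ℝ) : ℂ)) * (√(N + 1 : ℝ) : ℂ) = N + 1 := by
      rw [← Complex.ofReal_mul, Real.mul_self_sqrt h0]
      push_cast
      rfl
    have h2 : (N + 1 : ℂ) ≠ 0 := by exact_mod_cast N.succ_ne_zero
    have h3 : ∑ x ∈ Finset.range (N + 1), ∑ y ∈ Finset.range (N + 1),
        (if y = x then (1 : ℂ) else 0) = N + 1 := by
      simp only [Finset.sum_ite_eq']
      rw [Finset.sum_congr rfl fun x hx => if_pos hx]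
      simp
    simp only [true_and, ← Finset.mul_sum, h3]
    rw [map_inv₀, Complex.conj_ofReal, ← mul_assoc, ← mul_inv, h1, inv_mul_cancel₀ h2]
  · simp [h]

/-- Over any orthonormal family indexed by `ℕ × ℕ` there is an operator at distance at least `1/2`
from every operator whose matrix has boundedly many nonzero entries in each column: it spreads the
vector at the head of the `N`-th row of the index set evenly over `N + 1` vectors of that row. -/
theorem Orthonormal.exists_half_le_norm_sub_of_sparse [CompleteSpace H] {ξ : ℕ × ℕ → H}
    (hξ : Orthonormal ℂ ξ) :
    ∃ T : H →L[ℂ] H, ∀ (B : H →L[ℂ] H) (m : ℕ),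
      (∀ j, ∃ F : Finset (ℕ × ℕ), F.card ≤ m ∧ ∀ i ∉ F, ⟪ξ i, B (ξ j)⟫_ℂ = 0) →
        1 / 2 ≤ ‖T - B‖ := by
  classical
  have hhead : Orthonormal ℂ fun N : ℕ => ξ (N, 0) :=
    hξ.comp (fun N : ℕ => (N, 0)) fun _ _ h => congrArg Prod.fst h
  obtain ⟨T, hT⟩ := hhead.exists_continuousLinearMap_apply_eq (orthonormal_blockAverage hξ)
  refine ⟨T, fun B m hB => ?_⟩
  -- At `N = 2 * m` at least `m + 1` of the `2 * m + 1` spread coefficients are missed by `B`.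
  obtain ⟨F, hFm, hF⟩ := hB (2 * m, 0)
  let R : Finset (ℕ × ℕ) := (Finset.range (2 * m + 1)).image fun k => (2 * m, k)
  have hR : R.card = 2 * m + 1 := by
    rw [Finset.card_image_of_injective _ fun _ _ h => congrArg Prod.snd h, Finset.card_range]
  have hcard : m + 1 ≤ (R \ F).card := by
    have := Finset.le_card_sdiff F R
    omega
  have hcoef : ∀ i ∈ R \ F, ‖⟪ξ i, (T - B) (ξ (2 * m, 0))⟫_ℂ‖ ^ 2 = (2 * m + 1 : ℝ)⁻¹ := by
    intro i hi
    obtain ⟨hiR, hiF⟩ := Finset.mem_sdiff.1 hi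
    obtain ⟨k, hk, rfl⟩ := Finset.mem_image.1 hiR
    have hsum : ∑ l ∈ Finset.range (2 * m + 1), ⟪ξ (2 * m, k), ξ (2 * m, l)⟫_ℂ = 1 := by
      rw [orthonormal_iff_ite] at hξ
      simp only [hξ, Prod.mk.injEq, true_and, Finset.sum_ite_eq, if_pos hk]
    have h0 : (0 : ℝ) ≤ 2 * m + 1 := by positivity
    rw [sub_apply, inner_sub_right, hF _ hiF, sub_zero, hT (2 * m), inner_smul_right,
      inner_sum, hsum, mul_one, norm_inv, Complex.norm_real, Real.norm_eq_abs, inv_pow, sq_abs]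
    push_cast
    rw [Real.sq_sqrt h0]
  have hbessel := hξ.sum_inner_products_le (s := R \ F) ((T - B) (ξ (2 * m, 0)))
  rw [Finset.sum_congr rfl hcoef, Finset.sum_const, nsmul_eq_mul] at hbessel
  have hle : ‖(T - B) (ξ (2 * m, 0))‖ ≤ ‖T - B‖ := by
    simpa [hξ.1] using (T - B).le_opNorm (ξ (2 * m, 0))
  have hhalf : (1 / 2 : ℝ) ≤ (R \ F).card * (2 * m + 1 : ℝ)⁻¹ := by
    have h1 : (m + 1 : ℝ) ≤ (R \ F).card := by exact_mod_cast hcard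
    rw [← div_eq_mul_inv, div_le_div_iff₀ (by norm_num) (by positivity)]
    linarith
  have hsq := pow_le_pow_left₀ (norm_nonneg _) hle 2
  nlinarith [norm_nonneg (T - B)]

end HilbertSpace

/-! ### Isolated points from minimal projections -/

/-- If `C₀(Y) ≅ ℓ^∞(X)`, then `X` embeds into the isolated points of `Y`: the minimal projections
of `C₀(Y)` are the indicators of isolated points. -/
theorem exists_injective_isOpen_singleton {Y X : Type*} [TopologicalSpace Y] [T2Space Y]
    [LocallyCompactSpace Y] (φ : C₀(Y, ℂ) ≃⋆ₐ[ℂ] lp (fun _ : X => ℂ) ∞) :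
    ∃ p : X → Y, Function.Injective p ∧ ∀ x, IsOpen {p x} := by
  classical
  let δ : X → lp (fun _ : X => ℂ) ∞ := fun x => lp.single ∞ x 1
  let e : X → C₀(Y, ℂ) := fun x => φ.symm (δ x)
  have hδmul : ∀ x (a : lp (fun _ : X => ℂ) ∞), δ x * a = a x • δ x := by
    intro x a
    ext y
    rw [lp.infty_coeFn_mul, lp.coeFn_smul, Pi.mul_apply, Pi.smul_apply, lp.single_apply]
    by_cases h : y = x
    · subst h; simp
    · simp [h]
  have hδne : ∀ x, δ x ≠ 0 := by
    intro x h
    have := congrArg (fun a : lp (fun _ : X => ℂ) ∞ => a x) h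
    simp [δ] at this
  have hmul : ∀ x (g : C₀(Y, ℂ)), ∃ c : ℂ, e x * g = c • e x := by
    intro x g
    refine ⟨φ g x, EquivLike.injective φ ?_⟩
    rw [map_mul, map_smul, StarAlgEquiv.apply_symm_apply, hδmul]
  have hidem : ∀ x, e x * e x = e x := by
    intro x
    rw [← map_mul, hδmul]
    simp [δ, e]
  have hval : ∀ x y, e x y = 0 ∨ e x y = 1 := by
    intro x y
    have h := DFunLike.congr_fun (hidem x) y
    rw [ZeroAtInftyContinuousMap.mul_apply] at h
    rcases IsIdempotentElem.iff_eq_zero_or_one.1 h with h | h <;> simp [h]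
  have hex : ∀ x, ∃ y, e x y = 1 := by
    intro x
    by_contra! h
    refine hδne x (EquivLike.injective φ.symm ?_)
    rw [map_zero]
    ext y
    exact (hval x y).resolve_right (h y)
  choose p hp using hex
  -- A minimal projection vanishes off a single point, as `C₀(Y)` separates points.
  have huniq : ∀ x y, e x y = 1 → y = p x := by
    intro x y hy
    by_contra hne
    obtain ⟨f, hf1, hf0, hfc, -⟩ := exists_continuous_one_zero_of_isCompact
      (isCompact_singleton (x := y)) (isClosed_singleton (x := p x))
      (Set.disjoint_singleton.2 hne)
    let g : C₀(Y, ℂ) :=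
      { toFun := fun z => (f z : ℂ)
        continuous_toFun := by fun_prop
        zero_at_infty' := by
          have : HasCompactSupport fun z => (f z : ℂ) :=
            hfc.comp_left (g := fun r : ℝ => (r : ℂ)) Complex.ofReal_zero
          exact this.is_zero_at_infty }
    obtain ⟨c, hc⟩ := hmul x g
    have h1 := DFunLike.congr_fun hc y
    have h2 := DFunLike.congr_fun hc (p x)
    have g1 : g y = 1 := by
      have := hf1 (Set.mem_singleton y)
      simp [g, this]
    have g2 : g (p x) = 0 := by
      have := hf0 (Set.mem_singleton (p x))
      simp [g, this]
    simp only [ZeroAtInftyContinuousMap.mul_apply, ZeroAtInftyContinuousMap.smul_apply, hy, hp,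
      g1, g2, smul_eq_mul, mul_one, mul_zero] at h1 h2
    exact one_ne_zero (h1.trans h2.symm)
  refine ⟨p, fun x x' h => ?_, fun x => ?_⟩
  · by_contra hne
    have h0 : e x * e x' = 0 := by
      rw [← map_mul, hδmul, lp.single_apply_ne _ _ _ hne, zero_smul, map_zero]
    have h1 := DFunLike.congr_fun h0 (p x)
    rw [ZeroAtInftyContinuousMap.mul_apply, hp, h, hp] at h1
    simp at h1
  · have : {p x} = (e x) ⁻¹' {0}ᶜ := by
      ext y
      simp only [Set.mem_singleton_iff, Set.mem_preimage, Set.mem_compl_iff]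
      refine ⟨fun h => by simp [h, hp], fun h => huniq x y ((hval x y).resolve_left h)⟩
    rw [this]
    exact isOpen_compl_singleton.preimage (map_continuous (e x))

namespace TopGroupoid

/-! ### Indicators of isolated units -/

section Units

variable {G : Type*} [TopologicalSpace G] [TopGroupoid G]

theorem continuous_src : Continuous (src : G → G) := by
  have h : Continuous fun g : G => gmul (ginv g) g :=
    continuousOn_gmul.comp_continuous (continuous_ginv.prodMk continuous_id) fun g => src_ginv g
  simpa only [ginv_mul_self] using h

theorem isClosed_unitSpace [T2Space G] : IsClosed (unitSpace G) :=
  isClosed_eq continuous_src continuous_id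

theorem rng_unit (x : unitSpace G) : rng (x : G) = x := by
  have h := rng_src (x : G)
  rwa [show src (x : G) = x from x.2] at h

/-- A unit that is isolated in the unit space of an étale groupoid is an isolated arrow. -/
theorem IsEtale.isOpen_singleton_unit (hG : IsEtale G) {x : unitSpace G} (hx : IsOpen {x}) :
    IsOpen {(x : G)} := by
  obtain ⟨e, he, h⟩ := hG (x : G)
  have : {(x : G)} = e.source ∩ srcUnit ⁻¹' {x} := by
    ext g
    constructor
    · rintro rfl
      exact ⟨he, Subtype.ext x.2⟩
    · rintro ⟨hg, hgx⟩
      refine e.injOn hg he ?_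
      rw [← h]
      have hx' : srcUnit (x : G) = x := Subtype.ext x.2
      exact (hgx : srcUnit g = x).trans hx'.symm
  rw [this]
  exact e.open_source.inter (hx.preimage hG.continuous)

end Units

namespace Twist

variable {G S : Type*} [TopologicalSpace G] [TopGroupoid G] [TopologicalSpace S] [TopGroupoid S]

theorem fibreOperators_ext {T T' : FibreOperators G}
    (h : ∀ (u : unitSpace G) (ξ : lp (fun _ : Fibre u => ℂ) 2) (α : Fibre u),
      T u ξ α = T' u ξ α) : T = T' :=
  lp.ext (funext fun u => ContinuousLinearMap.ext fun ξ => lp.ext (funext fun α => h u ξ α))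

theorem fibreOperators_mul_apply (T T' : FibreOperators G) (u : unitSpace G)
    (ξ : lp (fun _ : Fibre u => ℂ) 2) : (T * T') u ξ = T u (T' u ξ) := by
  rw [lp.infty_coeFn_mul, Pi.mul_apply, mul_apply_eq_comp]

theorem proj_incl (E : Twist G S) (x : unitSpace G) (z : Circle) : E.proj (E.incl (x, z)) = x :=
  (E.proj_eq_iff x _).2 ⟨z, rfl⟩

theorem proj_act (E : Twist G S) (z : Circle) (σ : S) : E.proj (E.act z σ) = E.proj σ := by
  obtain ⟨w, hw⟩ := (E.proj_eq_iff (rngUnit (E.proj σ)) (rng σ)).1 (E.proj_rng σ)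
  have hrng : rng σ = E.incl (rngUnit (E.proj σ), 1) := by
    rw [← rng_rng σ, ← hw, E.rng_incl]
  rw [act, E.proj_mul _ _ ((E.src_incl _ _).trans hrng.symm), proj_incl]
  exact rng_mul_self _

theorem act_incl (E : Twist G S) (z w : Circle) (x : unitSpace G) :
    E.act z (E.incl (x, w)) = E.incl (x, z * w) := by
  have h : rngUnit (E.proj (E.incl (x, w))) = x :=
    Subtype.ext (by rw [proj_incl]; exact rng_unit x)
  rw [act, h, incl_mul]

theorem range_incl (E : Twist G S) (x : unitSpace G) :
    Set.range (fun z => E.incl (x, z)) = E.proj ⁻¹' {(x : G)} := by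
  ext σ
  exact (E.proj_eq_iff x σ).symm

theorem isOpenEmbedding_incl [T2Space S] (E : Twist G S) {x : unitSpace G}
    (hx : IsOpen {(x : G)}) : Topology.IsOpenEmbedding fun z => E.incl (x, z) := by
  have hc : Continuous fun z => E.incl (x, z) := E.continuous_incl.comp (by fun_prop)
  have hi : Function.Injective fun z => E.incl (x, z) := fun z w h =>
    congrArg Prod.snd (E.incl_injective h)
  refine ⟨(hc.isClosedEmbedding hi).isEmbedding, ?_⟩
  rw [range_incl]
  exact hx.preimage E.continuous_proj

/-- The section of the twist supported on the circle over an isolated unit `x` that is the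
inclusion `𝕋 → ℂ` there: the indicator function of `x`, as an element of `C_c(G, Σ)`. -/
noncomputable def unitSection [T2Space G] [T2Space S] (E : Twist G S) {x : unitSpace G}
    (hx : IsOpen {(x : G)}) : E.CompactSection where
  toFun := Function.extend (fun z => E.incl (x, z)) (fun z : Circle => (z : ℂ)) 0
  continuous_toFun := by
    have hemb := E.isOpenEmbedding_incl hx
    refine continuous_iff_continuousAt.2 fun σ => ?_
    by_cases hσ : σ ∈ Set.range fun z => E.incl (x, z)
    · obtain ⟨z, rfl⟩ := hσ
      rw [← hemb.continuousAt_iff, Function.extend_comp hemb.injective]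
      exact continuous_subtype_val.continuousAt
    · have hopen : IsOpen (Set.range fun z => E.incl (x, z))ᶜ := by
        rw [range_incl]
        exact (isClosed_singleton.preimage E.continuous_proj).isOpen_compl
      refine (continuousAt_const (y := (0 : ℂ))).congr ?_
      filter_upwards [hopen.mem_nhds hσ] with τ hτ
      exact (Function.extend_apply' (fun z : Circle => (z : ℂ)) (0 : S → ℂ) τ hτ).symm
  hasCompactSupport := by
    have hc : Continuous fun z => E.incl (x, z) := E.continuous_incl.comp (by fun_prop)
    exact HasCompactSupport.intro (isCompact_range hc) fun σ hσ =>
      Function.extend_apply' _ _ _ hσ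
  equivariant := by
    have hi := (E.isOpenEmbedding_incl hx).injective
    intro z σ
    by_cases hσ : ∃ w, E.incl (x, w) = σ
    · obtain ⟨w, rfl⟩ := hσ
      rw [act_incl, hi.extend_apply _ _ (z * w), hi.extend_apply _ _ w, Circle.coe_mul]
    · have hzσ : ¬ ∃ w, E.incl (x, w) = E.act z σ := by
        rwa [← proj_eq_iff, proj_act, proj_eq_iff]
      rw [Function.extend_apply' _ _ _ hσ, Function.extend_apply' _ _ _ hzσ]
      simp

open Classical in
/-- The regular representations turn the indicator of an isolated unit `x` into the projections
onto the functions supported on the arrows with range `x`. -/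
theorem regularRep_unitSection_apply [T2Space G] [T2Space S] (E : Twist G S) (hG : IsEtale G)
    {x : unitSpace G} (hx : IsOpen {(x : G)}) (u : unitSpace G)
    (ξ : lp (fun _ : Fibre u => ℂ) 2) (α : Fibre u) :
    E.regularRep hG (E.unitSection hx) u ξ α = if rng (α : G) = x then ξ α else 0 := by
  have hi := (E.isOpenEmbedding_incl hx).injective
  rw [regularRep_apply]
  have hne : ∀ β : Fibre u, (α ≠ β ∨ rng (α : G) ≠ x) →
      (E.unitSection hx).toFun (gmul (E.lift α) (ginv (E.lift β))) = 0 := by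
    intro β h
    have hαβ : src (α : G) = src (β : G) := α.2.trans β.2.symm
    refine Function.extend_apply' _ _ _ fun hσ => ?_
    have hprod : gmul (α : G) (ginv (β : G)) = x := by
      rw [← E.proj_lift_mul hαβ]
      exact (E.proj_eq_iff _ _).2 hσ
    have hrng : rng (α : G) = x := by
      rw [← rng_gmul (α : G) (ginv (β : G)) (by rw [rng_ginv, hαβ]), hprod, rng_unit]
    refine h.elim (fun h => h (Subtype.ext ?_)) fun h => h hrng
    exact gmul_ginv_injective rfl hαβ (by rw [hprod, mul_ginv_self, hrng])
  rw [tsum_eq_single α fun β hβ => by rw [hne β (Or.inl hβ.symm), zero_mul]]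
  split_ifs with h
  · have hone : gmul (E.lift (α : G)) (ginv (E.lift (α : G))) = E.incl (x, 1) := by
      obtain ⟨w, hw⟩ := (E.proj_eq_iff x (rng (E.lift (α : G)))).1 (by
        rw [E.proj_rng, proj_lift, h])
      rw [mul_ginv_self, ← rng_rng, ← hw, E.rng_incl]
    have : (E.unitSection hx).toFun (E.incl (x, 1)) = ((1 : Circle) : ℂ) :=
      hi.extend_apply _ _ 1
    rw [hone, this, Circle.coe_one, one_mul]
  · rw [hne α (Or.inr h), zero_mul]

end Twist

/-! ### Bounded propagation -/

section Propagation

variable {G : Type*} [TopologicalSpace G] [TopGroupoid G]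

/-- A relation relating every point to at most `m` points, on either side, for some `m`. -/
def BoundedDegree {V : Type*} (R : V → V → Prop) : Prop :=
  ∃ m : ℕ, ∀ y, (∃ F : Finset V, F.card ≤ m ∧ ∀ x, R x y → x ∈ F) ∧
    ∃ F : Finset V, F.card ≤ m ∧ ∀ x, R y x → x ∈ F

theorem BoundedDegree.sup {V : Type*} {R R' : V → V → Prop} (h : BoundedDegree R)
    (h' : BoundedDegree R') : BoundedDegree (R ⊔ R') := by
  classical
  obtain ⟨m, hm⟩ := h
  obtain ⟨m', hm'⟩ := h'
  refine ⟨m + m', fun y => ?_⟩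
  obtain ⟨⟨F, hF, hFR⟩, K, hK, hKR⟩ := hm y
  obtain ⟨⟨F', hF', hFR'⟩, K', hK', hKR'⟩ := hm' y
  refine ⟨⟨F ∪ F', (Finset.card_union_le _ _).trans (add_le_add hF hF'), fun x hx => ?_⟩,
    K ∪ K', (Finset.card_union_le _ _).trans (add_le_add hK hK'), fun x hx => ?_⟩
  · exact Finset.mem_union.2 (hx.imp (hFR x) (hFR' x))
  · exact Finset.mem_union.2 (hx.imp (hKR x) (hKR' x))

theorem BoundedDegree.comp {V : Type*} {R R' : V → V → Prop} (h : BoundedDegree R)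
    (h' : BoundedDegree R') : BoundedDegree (Relation.Comp R R') := by
  classical
  obtain ⟨m, hm⟩ := h
  obtain ⟨m', hm'⟩ := h'
  choose F hF hFR using fun y => (hm y).1
  choose K hK hKR using fun y => (hm y).2
  refine ⟨m * m', fun y => ?_⟩
  obtain ⟨⟨F', hF', hFR'⟩, -⟩ := hm' y
  choose K' hK' hKR' using fun y => (hm' y).2
  refine ⟨⟨F'.biUnion F, ?_, ?_⟩, (K y).biUnion K', ?_, ?_⟩
  · exact (Finset.card_biUnion_le_card_mul _ _ _ fun z _ => hF z).trans
      (by rw [mul_comm]; gcongr)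
  · rintro x ⟨z, hxz, hzy⟩
    exact Finset.mem_biUnion.2 ⟨z, hFR' z hzy, hFR z x hxz⟩
  · exact (Finset.card_biUnion_le_card_mul _ _ _ fun z _ => hK' z).trans (by gcongr; exact hK y)
  · rintro x ⟨z, hyz, hzx⟩
    exact Finset.mem_biUnion.2 ⟨z, hKR y z hyz, hKR' z x hzx⟩

theorem BoundedDegree.flip {V : Type*} {R : V → V → Prop} (h : BoundedDegree R) :
    BoundedDegree fun x y => R y x := by
  obtain ⟨m, hm⟩ := h
  exact ⟨m, fun y => (hm y).symm⟩

/-- The family `T` maps vectors supported on arrows with range in a set `Y` to vectors supported on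
arrows whose range is `R`-related to a point of `Y`. -/
def PropagatesAlong (R : G → G → Prop) (T : Twist.FibreOperators G) : Prop :=
  ∀ (u : unitSpace G) (Y : Set G) (ξ : lp (fun _ : Fibre u => ℂ) 2),
    (∀ β : Fibre u, ξ β ≠ 0 → rng (β : G) ∈ Y) →
      ∀ α : Fibre u, T u ξ α ≠ 0 → ∃ y ∈ Y, R (rng (α : G)) y

variable {R R' : G → G → Prop} {T T' : Twist.FibreOperators G}

theorem PropagatesAlong.add (h : PropagatesAlong R T) (h' : PropagatesAlong R' T') :
    PropagatesAlong (R ⊔ R') (T + T') := by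
  intro u Y ξ hξ α hα
  rw [lp.coeFn_add, Pi.add_apply, add_apply, lp.coeFn_add, Pi.add_apply] at hα
  by_cases h0 : T u ξ α = 0
  · obtain ⟨y, hy, hR⟩ := h' u Y ξ hξ α (by rwa [h0, zero_add] at hα)
    exact ⟨y, hy, Or.inr hR⟩
  · obtain ⟨y, hy, hR⟩ := h u Y ξ hξ α h0
    exact ⟨y, hy, Or.inl hR⟩

set_option synthInstance.maxHeartbeats 200000 in
theorem PropagatesAlong.smul (c : ℂ) (h : PropagatesAlong R T) : PropagatesAlong R (c • T) := by
  intro u Y ξ hξ α hα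
  rw [lp.coeFn_smul, Pi.smul_apply, smul_apply, lp.coeFn_smul, Pi.smul_apply] at hα
  exact h u Y ξ hξ α (right_ne_zero_of_smul hα)

theorem PropagatesAlong.mul (h : PropagatesAlong R T) (h' : PropagatesAlong R' T') :
    PropagatesAlong (Relation.Comp R R') (T * T') := by
  intro u Y ξ hξ α hα
  rw [lp.infty_coeFn_mul, Pi.mul_apply, mul_apply_eq_comp] at hα
  obtain ⟨z, ⟨y, hy, hzy⟩, hz⟩ := h u {z | ∃ y ∈ Y, R' z y} (T' u ξ) (h' u Y ξ hξ) α hα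
  exact ⟨y, hy, z, hz, hzy⟩

protected theorem PropagatesAlong.star (h : PropagatesAlong R T) :
    PropagatesAlong (fun x y => R y x) (star T) := by
  classical
  intro u Y ξ hξ α hα
  by_contra! hY
  -- `⟪δ_α, T* ξ⟫ = ⟪T δ_α, ξ⟫`, and the supports of `T δ_α` and `ξ` are disjoint.
  have key : inner ℂ (lp.single 2 α (1 : ℂ) : lp (fun _ : Fibre u => ℂ) 2)
      ((star T : Twist.FibreOperators G) u ξ) = 0 := by
    rw [lp.star_apply, ContinuousLinearMap.star_eq_adjoint,
      ContinuousLinearMap.adjoint_inner_right, lp.inner_eq_tsum]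
    refine (tsum_congr fun β => ?_).trans tsum_zero
    by_cases hβ : ξ β = 0
    · rw [hβ, inner_zero_right]
    · have : T u (lp.single 2 α 1) β = 0 := by
        by_contra hT
        obtain ⟨y, rfl, hR⟩ := h u {rng (α : G)} (lp.single 2 α 1) (fun γ hγ => by
          by_cases hγα : γ = α
          · rw [hγα]; rfl
          · exact absurd (lp.single_apply_ne _ _ _ hγα) hγ) β hT
        exact hY _ (hξ β hβ) hR
      rw [this, inner_zero_left]
  rw [lp.inner_single_left] at key
  exact hα (by simpa using key)

theorem propagatesAlong_zero : PropagatesAlong (fun _ _ : G => False) 0 := by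
  intro u Y ξ _ α hα
  simp at hα

variable {S : Type*} [TopologicalSpace S] [TopGroupoid S]

theorem exists_boundedDegree_propagatesAlong_regularRep (E : Twist G S) (hG : IsEtale G)
    (f : E.CompactSection) :
    ∃ R : G → G → Prop, BoundedDegree R ∧ PropagatesAlong R (E.regularRep hG f) := by
  classical
  let K := E.proj '' tsupport f.toFun
  obtain ⟨m, hm⟩ := hG.exists_fibre_bound (f.hasCompactSupport.image E.continuous_proj)
  have hfin : ∀ s : Set G, s.encard ≤ m → ∀ t : G → G,
      ∃ F : Finset G, F.card ≤ m ∧ ∀ g ∈ s, t g ∈ F := by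
    intro s hs t
    have hsf : s.Finite := Set.finite_of_encard_le_coe hs
    refine ⟨hsf.toFinset.image t, Finset.card_image_le.trans ?_, fun g hg =>
      Finset.mem_image_of_mem t (hsf.mem_toFinset.2 hg)⟩
    rw [hsf.encard_eq_coe_toFinset_card] at hs
    exact_mod_cast hs
  refine ⟨fun x y => ∃ g ∈ K, rng g = x ∧ src g = y, ⟨m, fun y => ?_⟩, ?_⟩
  · obtain ⟨F, hF, hFs⟩ := hfin _ (hm y).1 rng
    obtain ⟨F', hF', hFs'⟩ := hfin _ (hm y).2 src
    refine ⟨⟨F, hF, ?_⟩, F', hF', ?_⟩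
    · rintro _ ⟨g, hg, rfl, hy⟩
      exact hFs g ⟨hg, hy⟩
    · rintro _ ⟨g, hg, hy, rfl⟩
      exact hFs' g ⟨hg, hy⟩
  · intro u Y ξ hξ α hα
    rw [Twist.regularRep_apply] at hα
    obtain ⟨β, hβ⟩ : ∃ β : Fibre u,
        f.toFun (gmul (E.lift α) (ginv (E.lift β))) * ξ β ≠ 0 := by
      by_contra! h
      exact hα ((tsum_congr h).trans tsum_zero)
    have hαβ : src (α : G) = src (β : G) := α.2.trans β.2.symm
    have hc : src (α : G) = rng (ginv (β : G)) := by rw [rng_ginv, hαβ]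
    refine ⟨rng (β : G), hξ β (right_ne_zero_of_mul hβ), gmul (α : G) (ginv (β : G)), ?_,
      rng_gmul _ _ hc, by rw [src_gmul _ _ hc, src_ginv]⟩
    rw [← E.proj_lift_mul hαβ]
    exact Set.mem_image_of_mem _ (subset_tsupport _ (left_ne_zero_of_mul hβ))

/-- The elements of the ⋆-algebra generated by the compactly supported sections have bounded
propagation, a property that limits in norm need not have. -/
theorem exists_boundedDegree_propagatesAlong (E : Twist G S) (hG : IsEtale G)
    (hT : T ∈ NonUnitalStarAlgebra.adjoin ℂ (Set.range (E.regularRep hG))) :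
    ∃ R : G → G → Prop, BoundedDegree R ∧ PropagatesAlong R T := by
  induction hT using NonUnitalStarAlgebra.adjoin_induction with
  | mem x hx =>
    obtain ⟨f, rfl⟩ := hx
    exact exists_boundedDegree_propagatesAlong_regularRep E hG f
  | add x y _ _ hx hy =>
    obtain ⟨R, hR, hx⟩ := hx
    obtain ⟨R', hR', hy⟩ := hy
    exact ⟨_, hR.sup hR', hx.add hy⟩
  | zero => exact ⟨_, ⟨0, fun _ => ⟨⟨∅, by simp⟩, ∅, by simp⟩⟩, propagatesAlong_zero⟩
  | mul x y _ _ hx hy =>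
    obtain ⟨R, hR, hx⟩ := hx
    obtain ⟨R', hR', hy⟩ := hy
    exact ⟨_, hR.comp hR', hx.mul hy⟩
  | smul c x _ hx =>
    obtain ⟨R, hR, hx⟩ := hx
    exact ⟨R, hR, hx.smul c⟩
  | star x _ hx =>
    obtain ⟨R, hR, hx⟩ := hx
    exact ⟨_, hR.flip, hx.star⟩

end Propagation

end TopGroupoid

/-! ### Families of projections in a C⋆-algebra isomorphic to `B(H)` -/

/-- In a C⋆-algebra isomorphic to `B(H)`, given infinitely many nonzero orthogonal projections
`e i`, the elements `b` such that for each `j` the corner `e i * b * e j` is nonzero for boundedly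
many `i` only are not dense. -/
theorem StarAlgEquiv.exists_half_le_norm_sub_of_sparse {H : Type*} [NormedAddCommGroup H]
    [InnerProductSpace ℂ H] [CompleteSpace H] {A : Type*} [NonUnitalCStarAlgebra A]
    (φ : A ≃⋆ₐ[ℂ] (H →L[ℂ] H)) {e : ℕ × ℕ → A} (he_star : ∀ i, star (e i) = e i)
    (he_mul : ∀ i, e i * e i = e i) (he_orth : ∀ i j, i ≠ j → e i * e j = 0)
    (he_ne : ∀ i, e i ≠ 0) :
    ∃ a : A, ∀ (b : A) (m : ℕ),
      (∀ j, ∃ F : Finset (ℕ × ℕ), F.card ≤ m ∧ ∀ i ∉ F, e i * b * e j = 0) →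
        1 / 2 ≤ ‖a - b‖ := by
  have hφ_star : ∀ i, star (φ (e i)) = φ (e i) := fun i => by rw [← map_star, he_star]
  -- Unit vectors in the ranges of the projections `φ (e i)`.
  have hξ : ∀ i, ∃ ξ : H, ‖ξ‖ = 1 ∧ φ (e i) ξ = ξ := by
    intro i
    have h0 : φ (e i) ≠ 0 := fun h =>
      he_ne i (EquivLike.injective φ (h.trans (map_zero φ).symm))
    obtain ⟨v, hv⟩ := DFunLike.exists_ne h0
    have hv : φ (e i) v ≠ 0 := hv
    refine ⟨((‖φ (e i) v‖ : ℂ))⁻¹ • φ (e i) v, norm_smul_inv_norm hv, ?_⟩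
    rw [map_smul, ← mul_apply_eq_comp, ← map_mul, he_mul]
  choose ξ hξ1 hξe using hξ
  have hmove : ∀ i j (B : H →L[ℂ] H),
      inner ℂ (ξ i) (B (ξ j)) = inner ℂ (ξ i) ((φ (e i) * B * φ (e j)) (ξ j)) := by
    intro i j B
    rw [mul_apply_eq_comp, mul_apply_eq_comp, hξe j]
    rw [← hφ_star i]
    rw [ContinuousLinearMap.star_eq_adjoint, ContinuousLinearMap.adjoint_inner_right, hξe i]
  have horth : Orthonormal ℂ ξ := by
    refine ⟨hξ1, fun i j hij => ?_⟩
    have := hmove i j 1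
    rw [mul_one, ← map_mul, he_orth i j hij, map_zero] at this
    simpa using this
  obtain ⟨T, hT⟩ := horth.exists_half_le_norm_sub_of_sparse
  refine ⟨φ.symm T, fun b m hb => ?_⟩
  have hsparse : 1 / 2 ≤ ‖T - φ b‖ := by
    refine hT (φ b) m fun j => ?_
    obtain ⟨F, hFm, hF⟩ := hb j
    refine ⟨F, hFm, fun i hi => ?_⟩
    rw [hmove, ← map_mul, ← map_mul, hF i hi, map_zero]
    simp
  -- ⋆-homomorphisms between C⋆-algebras are contractive.
  have h := NonUnitalStarAlgHom.norm_apply_le φ (φ.symm T - b)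
  rw [map_sub, StarAlgEquiv.apply_symm_apply] at h
  exact hsparse.trans h

/-! ### The projections of the isolated units -/

namespace TopGroupoid.Twist

variable {G S : Type*} [TopologicalSpace G] [T2Space G] [TopGroupoid G] [TopologicalSpace S]
  [T2Space S] [TopGroupoid S] (E : Twist G S) (hG : IsEtale G)

theorem regularRep_unitSection_ne_zero {x : unitSpace G} (hx : IsOpen {(x : G)}) :
    E.regularRep hG (E.unitSection hx) ≠ 0 := by
  classical
  intro h
  let α : Fibre x := ⟨x, x.2⟩
  have h1 := E.regularRep_unitSection_apply hG hx x (lp.single 2 α 1) α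
  rw [if_pos (rng_unit x), lp.single_apply_self, h] at h1
  simp at h1

theorem star_regularRep_unitSection {x : unitSpace G} (hx : IsOpen {(x : G)}) :
    star (E.regularRep hG (E.unitSection hx)) = E.regularRep hG (E.unitSection hx) := by
  refine lp.ext (funext fun u => ?_)
  rw [lp.star_apply, ContinuousLinearMap.star_eq_adjoint, eq_comm,
    ContinuousLinearMap.eq_adjoint_iff]
  intro ξ η
  rw [lp.inner_eq_tsum, lp.inner_eq_tsum]
  refine tsum_congr fun α => ?_
  rw [regularRep_unitSection_apply, regularRep_unitSection_apply]
  split_ifs <;> simp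

theorem regularRep_unitSection_mul_self {x : unitSpace G} (hx : IsOpen {(x : G)}) :
    E.regularRep hG (E.unitSection hx) * E.regularRep hG (E.unitSection hx) =
      E.regularRep hG (E.unitSection hx) := by
  refine fibreOperators_ext fun u ξ α => ?_
  simp only [fibreOperators_mul_apply, regularRep_unitSection_apply]
  split_ifs <;> rfl

theorem regularRep_unitSection_mul_of_ne {x y : unitSpace G} (hx : IsOpen {(x : G)})
    (hy : IsOpen {(y : G)}) (hxy : x ≠ y) :
    E.regularRep hG (E.unitSection hx) * E.regularRep hG (E.unitSection hy) = 0 := by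
  refine fibreOperators_ext fun u ξ α => ?_
  simp only [fibreOperators_mul_apply, regularRep_unitSection_apply]
  split_ifs with h h'
  · exact absurd (Subtype.ext (h.symm.trans h')) hxy
  · simp
  · simp

theorem regularRep_unitSection_mul_mul_eq_zero {x y : unitSpace G} (hx : IsOpen {(x : G)})
    (hy : IsOpen {(y : G)}) {R : G → G → Prop} {T : FibreOperators G} (hT : PropagatesAlong R T)
    (hR : ¬ R x y) :
    E.regularRep hG (E.unitSection hx) * T * E.regularRep hG (E.unitSection hy) = 0 := by
  refine fibreOperators_ext fun u ξ α => ?_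
  simp only [fibreOperators_mul_apply, regularRep_unitSection_apply]
  split_ifs with h
  · by_contra h0
    obtain ⟨z, rfl, hz⟩ := hT u {(y : G)} _ (fun β hβ => by
      by_contra hβy
      exact hβ ((E.regularRep_unitSection_apply hG hy u ξ β).trans (if_neg hβy))) α h0
    exact hR (h ▸ hz)
  · simp

end TopGroupoid.Twist

set_option maxHeartbeats 1000000 in
open TopGroupoid Twist in
theorem theorem4p1
    {H : Type*} [NormedAddCommGroup H] [InnerProductSpace ℂ H] [CompleteSpace H]
    (hH : ¬ FiniteDimensional ℂ H)
    {G : Type*} [TopologicalSpace G] [T2Space G] [LocallyCompactSpace G] [TopGroupoid G]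
    (hG : TopGroupoid.IsEtale G)
    {S : Type*} [TopologicalSpace S] [T2Space S] [LocallyCompactSpace S] [TopGroupoid S]
    (E : TopGroupoid.Twist G S)
    {X : Type*} [Infinite X]
    (hX : Nonempty (C₀(TopGroupoid.unitSpace G, ℂ) ≃⋆ₐ[ℂ] lp (fun _ : X => ℂ) ∞)) :
    ¬ Nonempty (E.reducedCStarAlgebra hG ≃⋆ₐ[ℂ] (H →L[ℂ] H)) := by
  rintro ⟨φ⟩
  obtain ⟨φX⟩ := hX
  have : LocallyCompactSpace (unitSpace G) :=
    (isClosed_unitSpace (G := G)).isClosedEmbedding_subtypeVal.locallyCompactSpace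
  obtain ⟨p, hp, hpo⟩ := exists_injective_isOpen_singleton φX
  let q : ℕ × ℕ → unitSpace G := fun i => p (Infinite.natEmbedding X (Nat.pairEquiv i))
  have hq : Function.Injective q :=
    hp.comp ((Infinite.natEmbedding X).injective.comp Nat.pairEquiv.injective)
  have hqo : ∀ i, IsOpen {(q i : G)} := fun i => hG.isOpen_singleton_unit (hpo _)
  let A₀ := NonUnitalStarAlgebra.adjoin ℂ (Set.range (E.regularRep hG))
  have hA₀ : A₀ ≤ E.reducedCStarAlgebra hG := NonUnitalStarSubalgebra.le_topologicalClosure _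
  -- Closedness makes the subalgebra a `NonUnitalCStarAlgebra` by instance search.
  have hclosed : IsClosed (E.reducedCStarAlgebra hG : Set (FibreOperators G)) :=
    NonUnitalStarSubalgebra.isClosed_topologicalClosure _
  let e : ℕ × ℕ → E.reducedCStarAlgebra hG := fun i =>
    ⟨E.regularRep hG (E.unitSection (hqo i)),
      hA₀ (NonUnitalStarAlgebra.subset_adjoin ℂ _ (Set.mem_range_self _))⟩
  obtain ⟨a, ha⟩ := StarAlgEquiv.exists_half_le_norm_sub_of_sparse φ (e := e)
    (fun i => Subtype.ext (E.star_regularRep_unitSection hG (hqo i)))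
    (fun i => Subtype.ext (E.regularRep_unitSection_mul_self hG (hqo i)))
    (fun i j hij =>
      Subtype.ext (E.regularRep_unitSection_mul_of_ne hG (hqo i) (hqo j) (hq.ne hij)))
    (fun i h => E.regularRep_unitSection_ne_zero hG (hqo i) (congrArg Subtype.val h))
  -- `a` is within `1/2` of the dense ⋆-algebra, whose elements are sparse.
  obtain ⟨b, hb, hab⟩ : ∃ b ∈ A₀, dist (a : FibreOperators G) b < 1 / 2 :=
    Metric.mem_closure_iff.1 a.2 _ (by norm_num)
  obtain ⟨R, ⟨m, hm⟩, hR⟩ := exists_boundedDegree_propagatesAlong E hG hb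
  rw [dist_eq_norm] at hab
  refine absurd (ha ⟨b, hA₀ hb⟩ m fun j => ?_) (not_le.2 hab)
  obtain ⟨⟨F, hFm, hF⟩, -⟩ := hm (q j)
  have hinj : Function.Injective fun i => (q i : G) := Subtype.val_injective.comp hq
  refine ⟨F.preimage (fun i => (q i : G)) hinj.injOn,
    (Finset.card_le_card_of_injOn _ (fun i hi => Finset.mem_preimage.1 hi) hinj.injOn).trans hFm,
    fun i hi => Subtype.ext ?_⟩
  exact E.regularRep_unitSection_mul_mul_eq_zero hG (hqo i) (hqo j) hR fun h =>
    hi (Finset.mem_preimage.2 (hF _ h))
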